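/- Let $n\ge 1$ and $\hat\theta\in\mathbb R$. In terms of the eigenvalues $\lambda=(\lambda_1,\dots,\lambda_n)\in\mathbb R^n$ of $\omega^{-1}\chi$ at a point, the deformed Hermitian--Yang--Mills equation $\operatorname{Im}(\omega+\sqrt{-1}\,\chi)^n=\tan\hat\theta\cdot\operatorname{Re}(\omega+\sqrt{-1}\,\chi)^n$ reads $$\cos\hat\theta\cdot\operatorname{Im}\prod_{j=1}^n(1+\sqrt{-1}\,\lambda_j)=\sin\hat\theta\cdot\operatorname{Re}\prod_{j=1}^n(1+\sqrt{-1}\,\lambda_j)\qquad(*)$$ (multiplied by $\cos\hat\theta$, so that it also makes sense where $\tan\hat\theta$ is infinite). Let $S_{\hat\theta}=\{\lambda\in\mathbb R^n:\sum_{i=1}^n\arctan\lambda_i=\hat\theta\}$, and let $\Gamma_n=\{\lambda\in\mathbb R^n:\lambda_i>0\text{ for all }i\}$. (a) If $\hat\theta$ is a supercritical phase, that is, $\hat\theta\in\bigl((n-2)\tfrac{\pi}{2},\,n\tfrac{\pi}{2}\bigr)$, then the level set of the equation is convex. More precisely, $S_{\hat\theta}$ is a connected component of the solution set of $(*)$,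 and it is the only one that is contained in $q+\Gamma_n$ for some $q\in\mathbb R^n$; moreover, the region $\{\lambda:\sum_i\arctan\lambda_i>\hat\theta\}$ is a nonempty convex open proper subset of $\mathbb R^n$ with boundary $S_{\hat\theta}$. (b) If $\hat\theta\in\bigl(-n\tfrac{\pi}{2},\,-(n-2)\tfrac{\pi}{2}\bigr)$, then the level set is convex as well. More precisely, $S_{\hat\theta}$ is a connected component of the solution set of $(*)$, and it is the only one that is contained in $q-\Gamma_n$ for some $q\in\mathbb R^n$; moreover, the region $\{\lambda:\sum_i\arctan\lambda_i<\hat\theta\}$ is a nonempty convex open proper subset of $\mathbb R^n$ with boundary $S_{\hat\theta}$. -/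

import Mathlib

/-- The ratio `(ω + √-1 χ)ⁿ / ωⁿ` at a point, written in terms of the eigenvalues
`x 0, …, x (n - 1)` of `ω⁻¹ χ`. -/
noncomputable def dhymRatio {n : ℕ} (x : Fin n → ℝ) : ℂ :=
  ∏ j, (1 + Complex.I * (x j : ℂ))

/-- All `x ∈ ℝⁿ` that satisfy the deformed Hermitian--Yang--Mills equation
`Im (ω + √-1 χ)ⁿ = tan θ · Re (ω + √-1 χ)ⁿ` in terms of eigenvalues. The equation is multiplied by
`cos θ`, so that it is meaningful (and reads `Re (ω + √-1 χ)ⁿ = 0`) where `tan θ` is infinite. -/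
noncomputable def dhymSolutionSet (n : ℕ) (θ : ℝ) : Set (Fin n → ℝ) :=
  {x | Real.cos θ * (dhymRatio x).im = Real.sin θ * (dhymRatio x).re}

theorem mem_dhymSolutionSet_iff_tan {n : ℕ} {θ : ℝ} (h : Real.cos θ ≠ 0) (x : Fin n → ℝ) :
    x ∈ dhymSolutionSet n θ ↔ (dhymRatio x).im = Real.tan θ * (dhymRatio x).re := by
  simp only [dhymSolutionSet, Set.mem_ofPred_eq, Real.tan_eq_sin_div_cos]
  field_simp

/-- The phase `∑ arctan xᵢ`. -/
noncomputable def dhymPhase {n : ℕ} (x : Fin n → ℝ) : ℝ := ∑ i, Real.arctan (x i)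

/-- The level set `{∑ arctan xᵢ = θ}` of the deformed Hermitian--Yang--Mills equation of
phase `θ`. -/
noncomputable def dhymLevelSet (n : ℕ) (θ : ℝ) : Set (Fin n → ℝ) := {x | dhymPhase x = θ}

/-- `C` is one of the connected components of the subspace `F`. -/
def IsConnectedComponentOf {X : Type*} [TopologicalSpace X] (C F : Set X) : Prop :=
  ∃ x ∈ F, C = connectedComponentIn F x

/-- `S` is a convex hypersurface in `ℝⁿ` with enclosed region `K`: the region `K` is a nonempty
convex open proper subset of `ℝⁿ`, and `S` is its boundary. -/
structure IsConvexHypersurface {n : ℕ} (S K : Set (Fin n → ℝ)) : Prop where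
  isOpen : IsOpen K
  nonempty : K.Nonempty
  ne_univ : K ≠ Set.univ
  convex : Convex ℝ K
  frontier_eq : frontier K = S

/-! In polar form the equation says `sin (dhymPhase x - θ) = 0`, so its solution set is the disjoint
union of the level sets of phase `θ + kπ`. Each is connected, being a coordinatewise `tan` image of
a convex slice of a cube, so the nonempty ones are the components. Those of phase above `(n - 2)π/2`
are bounded below, those of phase below it are not; this singles out `k = 0`.

For convexity put `arccot = π/2 - arctan`. The region becomes `∑ arccot xᵢ < arccot a` for a fixed
`a`. Subtracting one `arccot xᵢ` from the right side replaces `a` by `(1 + a xᵢ)/(xᵢ - a)`, a convex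
function of `(a, xᵢ)`, so induction on the number of terms works once `a` may vary
(`sum_arccot_lt_convex`). Part (b) is part (a) under `x ↦ -x`. -/

open Real Set

section Phase

variable {n : ℕ}

theorem continuous_dhymPhase : Continuous (dhymPhase : (Fin n → ℝ) → ℝ) := by
  unfold dhymPhase
  fun_prop

theorem dhymPhase_neg (x : Fin n → ℝ) : dhymPhase (-x) = -dhymPhase x := by
  simp [dhymPhase, Real.arctan_neg]

theorem dhymPhase_lt (hn : 1 ≤ n) (x : Fin n → ℝ) : dhymPhase x < n * π / 2 := by
  have : Nonempty (Fin n) := ⟨⟨0, hn⟩⟩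
  have h : ∑ i : Fin n, arctan (x i) < ∑ _i : Fin n, π / 2 :=
    Finset.sum_lt_sum_of_nonempty Finset.univ_nonempty fun i _ => arctan_lt_pi_div_two (x i)
  simp only [Finset.sum_const, Finset.card_univ, Fintype.card_fin, nsmul_eq_mul] at h
  unfold dhymPhase
  linarith

theorem neg_lt_dhymPhase (hn : 1 ≤ n) (x : Fin n → ℝ) : -(n * π / 2) < dhymPhase x := by
  have := dhymPhase_lt hn (-x)
  rw [dhymPhase_neg] at this
  linarith

theorem dhymPhase_const_tan (hn : 1 ≤ n) {φ : ℝ} (h₁ : -(n * π / 2) < φ) (h₂ : φ < n * π / 2) :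
    dhymPhase (fun _ : Fin n => tan (φ / n)) = φ := by
  have hn' : (0 : ℝ) < n := by exact_mod_cast hn
  have : arctan (tan (φ / n)) = φ / n := by
    apply arctan_tan
    · rw [lt_div_iff₀ hn']; linarith
    · rw [div_lt_iff₀ hn']; linarith
  simp only [dhymPhase, this, Finset.sum_const, Finset.card_univ, Fintype.card_fin, nsmul_eq_mul]
  field_simp

/-- The phase strictly increases under translation by a positive multiple of `(1, …, 1)`. -/
theorem dhymPhase_lt_add_const (hn : 1 ≤ n) (x : Fin n → ℝ) {t : ℝ} (ht : 0 < t) :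
    dhymPhase x < dhymPhase (fun i => x i + t) := by
  have : Nonempty (Fin n) := ⟨⟨0, hn⟩⟩
  exact Finset.sum_lt_sum_of_nonempty Finset.univ_nonempty
    fun i _ => arctan_strictMono (lt_add_of_pos_right _ ht)

/-- Polar form of one factor of `dhymRatio`. -/
theorem one_add_I_mul_eq_polar (x : ℝ) :
    (1 + Complex.I * (x : ℂ)) = (√(1 + x ^ 2) : ℝ) * Complex.exp ((arctan x : ℝ) * Complex.I) := by
  have h : √(1 + x ^ 2) ≠ 0 := by positivity
  rw [Complex.exp_mul_I, ← Complex.ofReal_cos, ← Complex.ofReal_sin, cos_arctan, sin_arctan]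
  apply Complex.ext
  · simp [h]
  · simp only [Complex.add_im, Complex.one_im, Complex.mul_im, Complex.I_re, Complex.I_im,
      Complex.ofReal_re, Complex.ofReal_im, Complex.add_re, Complex.mul_re]
    field_simp
    ring

/-- Polar form of `dhymRatio`: its argument is the phase. -/
theorem exists_dhymRatio_eq_polar (x : Fin n → ℝ) :
    ∃ r : ℝ, 0 < r ∧ dhymRatio x = r * Complex.exp ((dhymPhase x : ℝ) * Complex.I) := by
  refine ⟨∏ i, √(1 + x i ^ 2), Finset.prod_pos fun i _ => by positivity, ?_⟩
  simp only [dhymRatio, dhymPhase, one_add_I_mul_eq_polar, Finset.prod_mul_distrib,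
    Complex.ofReal_prod, Complex.ofReal_sum, Finset.sum_mul, Complex.exp_sum]

theorem mem_dhymSolutionSet_iff {θ : ℝ} {x : Fin n → ℝ} :
    x ∈ dhymSolutionSet n θ ↔ ∃ k : ℤ, dhymPhase x = θ + k * π := by
  obtain ⟨r, hr, h⟩ := exists_dhymRatio_eq_polar x
  have h₁ : (dhymRatio x).re = r * cos (dhymPhase x) := by
    rw [h, Complex.re_ofReal_mul, Complex.exp_ofReal_mul_I_re]
  have h₂ : (dhymRatio x).im = r * sin (dhymPhase x) := by
    rw [h, Complex.im_ofReal_mul, Complex.exp_ofReal_mul_I_im]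
  have h₃ : x ∈ dhymSolutionSet n θ ↔ sin (dhymPhase x - θ) = 0 := by
    change cos θ * _ = sin θ * _ ↔ _
    rw [h₁, h₂, sin_sub, ← sub_eq_zero,
      show cos θ * (r * sin (dhymPhase x)) - sin θ * (r * cos (dhymPhase x))
        = r * (sin (dhymPhase x) * cos θ - cos (dhymPhase x) * sin θ) by ring,
      mul_eq_zero, or_iff_right hr.ne']
  rw [h₃, sin_eq_zero_iff]
  exact exists_congr fun k => ⟨fun h => by linarith, fun h => by linarith⟩

end Phase

/-! ### Connected components of the solution set -/

section Components

variable {n : ℕ}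

/-- In the coordinates `arctan xᵢ`, a level set of the phase is a slice of an open cube. -/
theorem isPreconnected_dhymLevelSet (φ : ℝ) : IsPreconnected (dhymLevelSet n φ) := by
  let P : Set (Fin n → ℝ) := Set.univ.pi (fun _ => Ioo (-(π / 2)) (π / 2)) ∩ {y | ∑ i, y i = φ}
  have hP : Convex ℝ P := by
    refine (convex_pi fun i _ => convex_Ioo _ _).inter ?_
    exact convex_hyperplane (f := fun y : Fin n → ℝ => ∑ i, y i)
      ⟨fun x y => by simp [Finset.sum_add_distrib], fun c x => by simp [Finset.mul_sum]⟩ φ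
  have hcont : ContinuousOn (fun (y : Fin n → ℝ) i => tan (y i)) P := by
    refine continuousOn_pi.2 fun i => ?_
    exact continuousOn_tan_Ioo.comp (continuous_apply i).continuousOn
      fun y hy => hy.1 i (mem_univ i)
  have himage : (fun (y : Fin n → ℝ) i => tan (y i)) '' P = dhymLevelSet n φ := by
    ext x
    constructor
    · rintro ⟨y, ⟨hy, hsum⟩, rfl⟩
      change ∑ i, arctan (tan (y i)) = φ
      rw [← show ∑ i, y i = φ from hsum]
      exact Finset.sum_congr rfl fun i _ =>
        arctan_tan (hy i (mem_univ i)).1 (hy i (mem_univ i)).2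
    · intro hx
      exact ⟨fun i => arctan (x i), ⟨fun i _ => arctan_mem_Ioo _, hx⟩, by simp [tan_arctan]⟩
  rw [← himage]
  exact hP.isPreconnected.image _ hcont

theorem dhymLevelSet_subset_dhymSolutionSet (θ : ℝ) (k : ℤ) :
    dhymLevelSet n (θ + k * π) ⊆ dhymSolutionSet n θ :=
  fun _ hx => mem_dhymSolutionSet_iff.2 ⟨k, hx⟩

/-- The phases on a component form an interval inside the discrete set `θ + πℤ`, hence a single
value. -/
theorem connectedComponentIn_dhymSolutionSet {θ : ℝ} {k : ℤ} {x : Fin n → ℝ}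
    (hx : x ∈ dhymLevelSet n (θ + k * π)) :
    connectedComponentIn (dhymSolutionSet n θ) x = dhymLevelSet n (θ + k * π) := by
  have hxF := dhymLevelSet_subset_dhymSolutionSet θ k hx
  apply Subset.antisymm
  · intro y hy
    obtain ⟨l, hl⟩ := mem_dhymSolutionSet_iff.1 (connectedComponentIn_subset _ _ hy)
    have hoc : (dhymPhase '' connectedComponentIn (dhymSolutionSet n θ) x).OrdConnected :=
      (isPreconnected_connectedComponentIn.image _ continuous_dhymPhase.continuousOn).ordConnected
    have hx' : dhymPhase x = θ + k * π := hx
    -- a phase strictly between two neighbouring admissible values is not admissible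
    have key : ∀ m : ℤ, θ + m * π + π / 2 ∉
        dhymPhase '' connectedComponentIn (dhymSolutionSet n θ) x := by
      rintro m ⟨z, hz, hzm⟩
      obtain ⟨j, hj⟩ := mem_dhymSolutionSet_iff.1 (connectedComponentIn_subset _ _ hz)
      have h : ((2 * j : ℤ) : ℝ) * π = ((2 * m + 1 : ℤ) : ℝ) * π := by push_cast; linarith
      have := Int.cast_injective (mul_right_cancel₀ pi_ne_zero h)
      omega
    have hxm := mem_image_of_mem dhymPhase (mem_connectedComponentIn hxF)
    have hym := mem_image_of_mem dhymPhase hy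
    rw [hx'] at hxm
    rw [hl] at hym
    have hpi := pi_pos
    rcases lt_trichotomy k l with hkl | hkl | hkl
    · have : (k : ℝ) + 1 ≤ l := by exact_mod_cast hkl
      exact absurd (hoc.out hxm hym ⟨by linarith, by nlinarith⟩) (key k)
    · exact hkl ▸ hl
    · have : (l : ℝ) + 1 ≤ k := by exact_mod_cast hkl
      exact absurd (hoc.out hym hxm ⟨by linarith, by nlinarith⟩) (key l)
  · exact (isPreconnected_dhymLevelSet _).subset_connectedComponentIn hx
      (dhymLevelSet_subset_dhymSolutionSet θ k)

/-- The connected components of the solution set are the nonempty level sets of the phase whose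
value is congruent to `θ` modulo `π`. -/
theorem isConnectedComponentOf_dhymSolutionSet_iff {θ : ℝ} {C : Set (Fin n → ℝ)} :
    IsConnectedComponentOf C (dhymSolutionSet n θ) ↔
      C.Nonempty ∧ ∃ k : ℤ, C = dhymLevelSet n (θ + k * π) := by
  constructor
  · rintro ⟨x, hx, rfl⟩
    obtain ⟨k, hk⟩ := mem_dhymSolutionSet_iff.1 hx
    exact ⟨⟨x, mem_connectedComponentIn hx⟩, k, connectedComponentIn_dhymSolutionSet hk⟩
  · rintro ⟨⟨x, hx⟩, k, rfl⟩
    exact ⟨x, dhymLevelSet_subset_dhymSolutionSet θ k hx,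
      (connectedComponentIn_dhymSolutionSet hx).symm⟩

end Components

/-! ### One-sided bounds on level sets -/

section Bounds

variable {n : ℕ}

theorem arctan_lower_bound_of_dhymPhase (x : Fin n → ℝ) (i : Fin n) :
    dhymPhase x - ((n : ℝ) - 1) * π / 2 ≤ arctan (x i) := by
  have h : ∑ j ∈ Finset.univ.erase i, arctan (x j) ≤ ∑ _j ∈ Finset.univ.erase i, π / 2 :=
    Finset.sum_le_sum fun j _ => (arctan_lt_pi_div_two (x j)).le
  have hn : 1 ≤ n := i.pos
  rw [Finset.sum_const, Finset.card_erase_of_mem (Finset.mem_univ i), Finset.card_univ,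
    Fintype.card_fin, nsmul_eq_mul, Nat.cast_sub hn, Nat.cast_one] at h
  have := Finset.add_sum_erase Finset.univ (fun j => arctan (x j)) (Finset.mem_univ i)
  simp only [dhymPhase]
  linarith

theorem exists_lower_bound_dhymLevelSet {φ : ℝ} (hφ : ((n : ℝ) - 2) * π / 2 < φ) :
    ∃ q : Fin n → ℝ, ∀ x ∈ dhymLevelSet n φ, ∀ i, q i < x i := by
  rcases lt_or_ge φ (n * π / 2) with h | h
  -- The other `n - 1` arctangents are at most `π/2` each; the `- 1` makes the bound strict.
  · refine ⟨fun _ => tan (φ - (n - 1) * π / 2) - 1, fun x hx i => ?_⟩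
    have h₁ := arctan_lower_bound_of_dhymPhase x i
    rw [show dhymPhase x = φ from hx] at h₁
    have h₂ : arctan (tan (φ - (n - 1) * π / 2)) = φ - (n - 1) * π / 2 :=
      arctan_tan (by linarith) (by linarith)
    rw [← h₂] at h₁
    have := arctan_strictMono.le_iff_le.1 h₁
    linarith
  -- Here the level set has no point, so any `q` serves.
  · refine ⟨0, fun x hx i => absurd (dhymPhase_lt i.pos x) ?_⟩
    rw [show dhymPhase x = φ from hx]
    exact h.not_gt

/-- The level sets of lower phase are unbounded in the negative direction. -/
theorem not_exists_lower_bound_dhymLevelSet (hn : 1 ≤ n) {φ : ℝ} (h₁ : -(n * π / 2) < φ)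
    (h₂ : φ < ((n : ℝ) - 2) * π / 2) :
    ¬ ∃ q : Fin n → ℝ, ∀ x ∈ dhymLevelSet n φ, ∀ i, q i < x i := by
  rintro ⟨q, hq⟩
  obtain ⟨m, rfl⟩ : ∃ m, n = m + 1 := ⟨n - 1, by omega⟩
  push_cast at h₁ h₂
  have hpi := pi_pos
  have hm : (0 : ℝ) < m := by
    by_contra hm
    nlinarith [Nat.cast_nonneg (α := ℝ) m]
  -- Coordinate `0` gets angle `a`, violating the bound `q 0`; the other `m` share `φ - a` equally.
  -- The second bound on `a` keeps each share above `-π/2`, and `a > -π/2` with `h₂` keeps it below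
  -- `π/2`.
  obtain ⟨a, ha, ha'⟩ : ∃ a, -(π / 2) < a ∧ a < min (arctan (q 0)) (φ + m * π / 2) :=
    exists_between (lt_min (neg_pi_div_two_lt_arctan _) (by linarith))
  have ha₁ := ha'.trans_le (min_le_left _ _)
  have ha₂ := ha'.trans_le (min_le_right _ _)
  have haπ : a < π / 2 := ha₁.trans (arctan_lt_pi_div_two _)
  have hb : arctan (tan ((φ - a) / m)) = (φ - a) / m := by
    apply arctan_tan
    · rw [lt_div_iff₀ hm]; linarith
    · rw [div_lt_iff₀ hm]; linarith
  have hx : (Fin.cons (tan a) (fun _ => tan ((φ - a) / m)) : Fin (m + 1) → ℝ) ∈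
      dhymLevelSet (m + 1) φ := by
    change ∑ i, arctan _ = φ
    rw [Fin.sum_univ_succ]
    simp only [Fin.cons_zero, Fin.cons_succ, arctan_tan ha haπ, hb, Finset.sum_const,
      Finset.card_univ, Fintype.card_fin, nsmul_eq_mul]
    field_simp
    ring
  have := arctan_strictMono (hq _ hx 0)
  rw [Fin.cons_zero, arctan_tan ha haπ] at this
  linarith

end Bounds

/-! ### Convexity of the superlevel region -/

section Convexity

theorem arctan_one_add_mul_div_sub {a x : ℝ} (h : a < x) :
    arctan ((1 + a * x) / (x - a)) = π / 2 + arctan a - arctan x := by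
  have hlt := arctan_strictMono h
  have h₁ := neg_pi_div_two_lt_arctan a
  have h₂ := arctan_lt_pi_div_two x
  have hxa : x - a ≠ 0 := (sub_pos.2 h).ne'
  have hx : √(1 + x ^ 2) ≠ 0 := by positivity
  have ha : √(1 + a ^ 2) ≠ 0 := by positivity
  refine arctan_eq_of_tan_eq ?_ ⟨by linarith, by linarith⟩
  rw [show π / 2 + arctan a - arctan x = π / 2 - (arctan x - arctan a) by ring,
    tan_eq_sin_div_cos, sin_pi_div_two_sub, cos_pi_div_two_sub, cos_sub, sin_sub, cos_arctan,
    cos_arctan, sin_arctan, sin_arctan]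
  have e₁ : 1 / √(1 + x ^ 2) * (1 / √(1 + a ^ 2)) + x / √(1 + x ^ 2) * (a / √(1 + a ^ 2))
      = (1 + a * x) / (√(1 + x ^ 2) * √(1 + a ^ 2)) := by field_simp
  have e₂ : x / √(1 + x ^ 2) * (1 / √(1 + a ^ 2)) - 1 / √(1 + x ^ 2) * (a / √(1 + a ^ 2))
      = (x - a) / (√(1 + x ^ 2) * √(1 + a ^ 2)) := by field_simp
  rw [e₁, e₂]
  field_simp

/-- The function `(a, x) ↦ (1 + a x) / (x - a)` is convex on the half-plane `a < x`. -/
theorem one_add_mul_div_sub_convex {a x b y s t : ℝ} (ha : a < x) (hb : b < y) (hs : 0 ≤ s)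
    (ht : 0 ≤ t) (hst : s + t = 1) :
    (1 + (s * a + t * b) * (s * x + t * y)) / ((s * x + t * y) - (s * a + t * b)) ≤
      s * ((1 + a * x) / (x - a)) + t * ((1 + b * y) / (y - b)) := by
  -- With `u = x - a` the function is `a + (1 + a²)/u`, linear plus quadratic over linear; `e` gives
  -- the convexity gap explicitly.
  obtain ⟨u, rfl⟩ : ∃ u, x = a + u := ⟨x - a, by ring⟩
  obtain ⟨v, rfl⟩ : ∃ v, y = b + v := ⟨y - b, by ring⟩
  have hu : 0 < u := by linarith
  have hv : 0 < v := by linarith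
  have hw : 0 < s * u + t * v := by
    rcases hs.eq_or_lt with rfl | hs
    · have : t = 1 := by linarith
      subst this; linarith
    · nlinarith [mul_pos hs hu, mul_nonneg ht hv.le]
  obtain rfl : t = 1 - s := by linarith
  have e : s * ((1 + a * (a + u)) / (a + u - a)) + (1 - s) * ((1 + b * (b + v)) / (b + v - b))
      - (1 + (s * a + (1 - s) * b) * (s * (a + u) + (1 - s) * (b + v))) /
        ((s * (a + u) + (1 - s) * (b + v)) - (s * a + (1 - s) * b))
      = s * (1 - s) * ((u - v) ^ 2 + (a * v - b * u) ^ 2) / (u * v * (s * u + (1 - s) * v)) := by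
    rw [show a + u - a = u by ring, show b + v - b = v by ring,
      show (s * (a + u) + (1 - s) * (b + v)) - (s * a + (1 - s) * b) = s * u + (1 - s) * v by ring]
    have := hw.ne'
    field_simp
    ring
  rw [← sub_nonneg, e]
  positivity

/-- With `arccot = π / 2 - arctan`, the condition `∑ arccot xᵢ < arccot a` is convex in `(x, a)`. -/
theorem sum_arccot_lt_convex {ι : Type*} (S : Finset ι) {x y : ι → ℝ} {s t : ℝ} (hs : 0 ≤ s)
    (ht : 0 ≤ t) (hst : s + t = 1) {a b : ℝ}
    (hx : ∑ i ∈ S, (π / 2 - arctan (x i)) < π / 2 - arctan a)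
    (hy : ∑ i ∈ S, (π / 2 - arctan (y i)) < π / 2 - arctan b) :
    ∑ i ∈ S, (π / 2 - arctan (s * x i + t * y i)) < π / 2 - arctan (s * a + t * b) := by
  classical
  induction S using Finset.induction_on generalizing a b with
  | empty => simpa using arctan_lt_pi_div_two (s * a + t * b)
  | insert i S hi ih =>
    rw [Finset.sum_insert hi] at hx hy ⊢
    have hnonneg : ∀ z : ι → ℝ, 0 ≤ ∑ j ∈ S, (π / 2 - arctan (z j)) := fun z =>
      Finset.sum_nonneg fun j _ => sub_nonneg.2 (arctan_lt_pi_div_two (z j)).le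
    have hax : a < x i := arctan_strictMono.lt_iff_lt.1 (by linarith [hnonneg x])
    have hby : b < y i := arctan_strictMono.lt_iff_lt.1 (by linarith [hnonneg y])
    have hz : s * a + t * b < s * x i + t * y i := by
      rcases hs.eq_or_lt with rfl | hs
      · have : t = 1 := by linarith
        subst this; linarith
      · nlinarith [mul_pos hs (sub_pos.2 hax), mul_nonneg ht (sub_pos.2 hby).le]
    -- The term of index `i` is absorbed into the thresholds.
    have h := ih (a := (1 + a * x i) / (x i - a)) (b := (1 + b * y i) / (y i - b))
      (by rw [arctan_one_add_mul_div_sub hax]; linarith)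
      (by rw [arctan_one_add_mul_div_sub hby]; linarith)
    have hmono := arctan_strictMono.monotone (one_add_mul_div_sub_convex hax hby hs ht hst)
    rw [arctan_one_add_mul_div_sub hz] at hmono
    linarith

variable {n : ℕ}

theorem convex_setOf_lt_dhymPhase {θ : ℝ} (h₁ : ((n : ℝ) - 2) * π / 2 < θ)
    (h₂ : θ < n * π / 2) : Convex ℝ {x : Fin n → ℝ | θ < dhymPhase x} := by
  have harctan : arctan (tan (θ - (n - 1) * π / 2)) = θ - (n - 1) * π / 2 :=
    arctan_tan (by linarith) (by linarith)
  have key : ∀ x : Fin n → ℝ, θ < dhymPhase x ↔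
      ∑ i, (π / 2 - arctan (x i)) < π / 2 - arctan (tan (θ - (n - 1) * π / 2)) := by
    intro x
    rw [harctan, Finset.sum_sub_distrib, Finset.sum_const, Finset.card_univ, Fintype.card_fin,
      nsmul_eq_mul, dhymPhase]
    constructor <;> intro h <;> linarith
  intro x hx y hy s t hs ht hst
  have h := sum_arccot_lt_convex Finset.univ hs ht hst ((key x).1 hx) ((key y).1 hy)
  rw [← add_mul, hst, one_mul] at h
  exact (key _).2 h

theorem isConvexHypersurface_dhymLevelSet (hn : 1 ≤ n) {θ : ℝ} (h₁ : ((n : ℝ) - 2) * π / 2 < θ)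
    (h₂ : θ < n * π / 2) :
    IsConvexHypersurface (dhymLevelSet n θ) {x | θ < dhymPhase x} where
  isOpen := isOpen_lt continuous_const continuous_dhymPhase
  nonempty := by
    have hn' : (1 : ℝ) ≤ n := by exact_mod_cast hn
    obtain ⟨φ, hφ, hφ'⟩ := exists_between h₂
    refine ⟨fun _ => tan (φ / n), ?_⟩
    rw [mem_ofPred_eq, dhymPhase_const_tan hn (by nlinarith [pi_pos]) hφ']
    exact hφ
  ne_univ := by
    have hn' : (1 : ℝ) ≤ n := by exact_mod_cast hn
    intro h
    have : θ < dhymPhase (fun _ : Fin n => tan (θ / n)) :=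
      h.ge (mem_univ (fun _ : Fin n => tan (θ / n)))
    rw [dhymPhase_const_tan hn (by nlinarith [pi_pos]) h₂] at this
    exact lt_irrefl _ this
  convex := convex_setOf_lt_dhymPhase h₁ h₂
  frontier_eq := by
    apply Subset.antisymm
    · intro x hx
      exact (frontier_lt_subset_eq continuous_const continuous_dhymPhase hx).symm
    · intro x hx
      have hx' : dhymPhase x = θ := hx
      rw [(isOpen_lt continuous_const continuous_dhymPhase).frontier_eq]
      refine ⟨?_, fun h => (lt_irrefl θ) (hx' ▸ h)⟩
      -- Points of the level set are limits of their diagonal translates, which have larger phase.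
      have hlim : Filter.Tendsto (fun t : ℝ => fun i => x i + t) (nhdsWithin 0 (Ioi 0))
          (nhds x) := by
        have hc : Continuous fun t : ℝ => fun i => x i + t := by fun_prop
        simpa using (hc.tendsto 0).mono_left nhdsWithin_le_nhds
      refine mem_closure_of_tendsto hlim ?_
      filter_upwards [self_mem_nhdsWithin] with t ht
      exact hx' ▸ dhymPhase_lt_add_const hn x ht

end Convexity

/-! ### Reflection `x ↦ -x` -/

section Negation

variable {n : ℕ}

theorem neg_mem_dhymLevelSet_iff {φ : ℝ} {x : Fin n → ℝ} :
    -x ∈ dhymLevelSet n φ ↔ x ∈ dhymLevelSet n (-φ) := by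
  change dhymPhase (-x) = φ ↔ dhymPhase x = -φ
  rw [dhymPhase_neg, neg_eq_iff_eq_neg]

theorem exists_upper_bound_dhymLevelSet_iff {φ : ℝ} :
    (∃ q : Fin n → ℝ, ∀ x ∈ dhymLevelSet n φ, ∀ i, x i < q i) ↔
      ∃ q : Fin n → ℝ, ∀ x ∈ dhymLevelSet n (-φ), ∀ i, q i < x i := by
  constructor
  · rintro ⟨q, hq⟩
    exact ⟨-q, fun x hx i => neg_lt.1 (hq (-x) (neg_mem_dhymLevelSet_iff.2 hx) i)⟩
  · rintro ⟨q, hq⟩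
    refine ⟨-q, fun x hx i => lt_neg.1 (hq (-x) (neg_mem_dhymLevelSet_iff.2 ?_) i)⟩
    rwa [neg_neg]

theorem IsConvexHypersurface.neg {S K : Set (Fin n → ℝ)} (h : IsConvexHypersurface S K) :
    IsConvexHypersurface (Neg.neg ⁻¹' S) (Neg.neg ⁻¹' K) where
  isOpen := h.isOpen.preimage continuous_neg
  nonempty := h.nonempty.preimage neg_surjective
  ne_univ := fun hK => h.ne_univ (by
    rw [← image_preimage_eq K neg_surjective, hK, image_univ, neg_surjective.range_eq])
  convex := h.convex.is_linear_preimage (LinearMap.isLinear (-LinearMap.id))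
  frontier_eq := by
    rw [← h.frontier_eq]
    exact ((Homeomorph.neg (Fin n → ℝ)).preimage_frontier K).symm

end Negation

/-- Among the connected components of the solution set, the level set of a supercritical phase is
the only one that is bounded below. -/
theorem isConnectedComponentOf_and_lower_bound_iff {n : ℕ} (hn : 1 ≤ n) {θ : ℝ}
    (h₁ : ((n : ℝ) - 2) * π / 2 < θ) (h₂ : θ < n * π / 2) (C : Set (Fin n → ℝ)) :
    (IsConnectedComponentOf C (dhymSolutionSet n θ) ∧
      ∃ q : Fin n → ℝ, ∀ x ∈ C, ∀ i, q i < x i) ↔ C = dhymLevelSet n θ := by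
  have hn' : (1 : ℝ) ≤ n := by exact_mod_cast hn
  have hpi := pi_pos
  rw [isConnectedComponentOf_dhymSolutionSet_iff]
  constructor
  · rintro ⟨⟨⟨x, hx⟩, k, rfl⟩, hq⟩
    have hx' : dhymPhase x = θ + k * π := hx
    have hlow := neg_lt_dhymPhase hn x
    have hupp := dhymPhase_lt hn x
    rw [hx'] at hlow hupp
    -- For `k ≤ -1` the phase drops below `(n - 2)π/2`; for `k ≥ 1` it exceeds `nπ/2`.
    have hk : k = 0 := by
      rcases lt_trichotomy k 0 with hk | hk | hk
      · have : (k : ℝ) ≤ -1 := by exact_mod_cast Int.le_sub_one_of_lt hk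
        exact absurd hq (not_exists_lower_bound_dhymLevelSet hn hlow (by nlinarith))
      · exact hk
      · have : (1 : ℝ) ≤ k := by exact_mod_cast hk
        nlinarith
    simp [hk]
  · rintro rfl
    exact ⟨⟨⟨_, dhymPhase_const_tan hn (by nlinarith) h₂⟩, 0, by simp⟩,
      exists_lower_bound_dhymLevelSet h₁⟩

/-- Among the connected components of the solution set, the level set of a phase below
`-(n - 2) π / 2` is the only one that is bounded above. -/
theorem isConnectedComponentOf_and_upper_bound_iff {n : ℕ} (hn : 1 ≤ n) {θ : ℝ}
    (h₁ : -((n : ℝ) * π / 2) < θ) (h₂ : θ < -(((n : ℝ) - 2) * π / 2)) (C : Set (Fin n → ℝ)) :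
    (IsConnectedComponentOf C (dhymSolutionSet n θ) ∧
      ∃ q : Fin n → ℝ, ∀ x ∈ C, ∀ i, x i < q i) ↔ C = dhymLevelSet n θ := by
  have hlevel : ∀ φ : ℝ, dhymLevelSet n φ = Neg.neg ⁻¹' dhymLevelSet n (-φ) := fun φ => by
    ext x; rw [mem_preimage, neg_mem_dhymLevelSet_iff, neg_neg]
  have hneg := isConnectedComponentOf_and_lower_bound_iff hn (θ := -θ) (by linarith) (by linarith)
  constructor
  · rintro ⟨hC, hq⟩
    obtain ⟨⟨x, hx⟩, k, rfl⟩ := isConnectedComponentOf_dhymSolutionSet_iff.1 hC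
    rw [exists_upper_bound_dhymLevelSet_iff] at hq
    have hk : -(θ + k * π) = -θ + (-k : ℤ) * π := by push_cast; ring
    rw [hlevel, (hneg (dhymLevelSet n (-(θ + k * π)))).1
      ⟨isConnectedComponentOf_dhymSolutionSet_iff.2
        ⟨⟨-x, by rw [neg_mem_dhymLevelSet_iff, neg_neg]; exact hx⟩, -k, by rw [hk]⟩, hq⟩,
      ← hlevel]
  · rintro rfl
    obtain ⟨hC, hq⟩ := (hneg (dhymLevelSet n (-θ))).2 rfl
    obtain ⟨⟨x, hx⟩, -⟩ := isConnectedComponentOf_dhymSolutionSet_iff.1 hC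
    exact ⟨isConnectedComponentOf_dhymSolutionSet_iff.2
      ⟨⟨-x, neg_mem_dhymLevelSet_iff.2 hx⟩, 0, by simp⟩,
      exists_upper_bound_dhymLevelSet_iff.2 hq⟩

theorem isConvexHypersurface_dhymLevelSet_of_lt {n : ℕ} (hn : 1 ≤ n) {θ : ℝ}
    (h₁ : -((n : ℝ) * π / 2) < θ) (h₂ : θ < -(((n : ℝ) - 2) * π / 2)) :
    IsConvexHypersurface (dhymLevelSet n θ) {x | dhymPhase x < θ} := by
  have h := (isConvexHypersurface_dhymLevelSet hn (θ := -θ) (by linarith) (by linarith)).neg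
  have e₁ : Neg.neg ⁻¹' dhymLevelSet n (-θ) = dhymLevelSet n θ := by
    ext x; rw [mem_preimage, neg_mem_dhymLevelSet_iff, neg_neg]
  have e₂ : Neg.neg ⁻¹' {x : Fin n → ℝ | -θ < dhymPhase x} = {x | dhymPhase x < θ} := by
    ext x
    rw [mem_preimage, mem_ofPred_eq, mem_ofPred_eq, dhymPhase_neg, neg_lt_neg_iff]
  rwa [e₁, e₂] at h

theorem mainTheorem9 (n : ℕ) (hn : 1 ≤ n) (θ : ℝ) :
    (θ ∈ Set.Ioo (((n : ℝ) - 2) * Real.pi / 2) ((n : ℝ) * Real.pi / 2) →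
      (∀ C : Set (Fin n → ℝ),
        (IsConnectedComponentOf C (dhymSolutionSet n θ) ∧
          ∃ q : Fin n → ℝ, ∀ x ∈ C, ∀ i, q i < x i) ↔ C = dhymLevelSet n θ) ∧
      IsConvexHypersurface (dhymLevelSet n θ) {x | θ < dhymPhase x}) ∧
    (θ ∈ Set.Ioo (-((n : ℝ) * Real.pi / 2)) (-(((n : ℝ) - 2) * Real.pi / 2)) →
      (∀ C : Set (Fin n → ℝ),
        (IsConnectedComponentOf C (dhymSolutionSet n θ) ∧
          ∃ q : Fin n → ℝ, ∀ x ∈ C, ∀ i, x i < q i) ↔ C = dhymLevelSet n θ) ∧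
      IsConvexHypersurface (dhymLevelSet n θ) {x | dhymPhase x < θ}) :=
  ⟨fun h => ⟨isConnectedComponentOf_and_lower_bound_iff hn h.1 h.2,
      isConvexHypersurface_dhymLevelSet hn h.1 h.2⟩,
    fun h => ⟨isConnectedComponentOf_and_upper_bound_iff hn h.1 h.2,
      isConvexHypersurface_dhymLevelSet_of_lt hn h.1 h.2⟩⟩
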